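/- Let $n\ge 3$ and let $p_0,p_1,\dots,p_{n-1}$ be $n$ distinct points of $\mathbb R^2$; put $p_n=p_0$ and let $P=\bigcup_{i=1}^n[p_{i-1},p_i]$. Assume that $P$ is a simple closed $n$-gon, i.e. two (cyclically) consecutive edges $[p_{i-1},p_i]$ meet only in their common endpoint, and two non-consecutive edges are disjoint. Let $\operatorname{int}P$ [resp. $\operatorname{ext}P$] be the set of all points of $\mathbb R^2\setminus P$ that lie in a bounded [resp. unbounded] connected component of $\mathbb R^2\setminus P$. For $S\subseteq\mathbb R^2$ and $a,b\in S$ let $\pi_S(a,b)\in\{0,1,2,\dots,\infty\}$ be the smallest number of edges of a polygonal path that connects $a$ to $b$ within $S$ ($\infty$ if there is no such path), and let $\operatorname{poldiam}(S)=\sup\{\pi_S(a,b):a,b\in S\}$. Then $$\operatorname{poldiam}(\operatorname{int}P)\le\left\lfloor\frac n2\right\rfloor+3\qquad\text{and}\qquad\operatorname{poldiam}(\operatorname{ext}P)\le\left\lfloor\frac n2\right\rfloor+3 .$$ In particular, in each of $\operatorname{int}P$ and $\operatorname{ext}P$ any two points are connected by a polygonal path within that set. Moreover, $\operatorname{int}P$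 and $\operatorname{ext}P$ are non-empty and connected, so that they are the bounded and the unbounded component of $\mathbb R^2\setminus P$ (the connectivity part of the Jordan theorem for polygons). -/

import Mathlib

namespace PolygonalDiameter

/-- The Euclidean plane. -/
abbrev Plane : Type := EuclideanSpace ℝ (Fin 2)

/-- The closed polygon with (cyclically ordered) vertices `P 0, …, P (n - 1)` is simple: the
vertices are distinct, two consecutive edges meet exactly in their common endpoint, and two edges
that are not consecutive are disjoint. The `i`-th edge `P.edgeSet ℝ i` is the closed segment from
`P i` to the cyclically next vertex `P (finRotate n i)`. -/
structure IsSimple {n : ℕ} (P : Polygon Plane n) : Prop where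
  injective : Function.Injective P.vertices
  consecutive : ∀ i : Fin n,
    P.edgeSet ℝ i ∩ P.edgeSet ℝ (finRotate n i) = {P (finRotate n i)}
  nonconsecutive : ∀ i j : Fin n, i ≠ j → j ≠ finRotate n i → i ≠ finRotate n j →
    Disjoint (P.edgeSet ℝ i) (P.edgeSet ℝ j)

/-- The interior of a closed polygon: the points off the polygon (i.e. off the union
`P.boundary ℝ` of its edges) whose connected component in the complement of the polygon is
bounded. -/
def inside {n : ℕ} (P : Polygon Plane n) : Set Plane :=
  {x | x ∉ P.boundary ℝ ∧ Bornology.IsBounded (connectedComponentIn (P.boundary ℝ)ᶜ x)}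

/-- The exterior of a closed polygon: the points off the polygon whose connected component in the
complement of the polygon is unbounded. -/
def outside {n : ℕ} (P : Polygon Plane n) : Set Plane :=
  {x | x ∉ P.boundary ℝ ∧ ¬ Bornology.IsBounded (connectedComponentIn (P.boundary ℝ)ᶜ x)}

/-- `q 0, q 1, …, q k` are the successive vertices of a polygonal path with `k` edges that connects
`a` to `b` within `S`. -/
structure IsPolygonalPath (S : Set Plane) (a b : Plane) {k : ℕ} (q : Fin (k + 1) → Plane) :
    Prop where
  source : q 0 = a
  target : q (Fin.last k) = b
  vertex_mem : ∀ i : Fin (k + 1), q i ∈ S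
  edge_subset : ∀ i : Fin k, segment ℝ (q i.castSucc) (q i.succ) ⊆ S

/-- The smallest number of edges of a polygonal path that connects `a` to `b` within `S`;
it is `⊤` if there is no such path. -/
noncomputable def polDist (S : Set Plane) (a b : Plane) : ℕ∞ :=
  ⨅ (k : ℕ) (_ : ∃ q : Fin (k + 1) → Plane, IsPolygonalPath S a b q), (k : ℕ∞)

/-- The polygonal diameter of `S`. -/
noncomputable def poldiam (S : Set Plane) : ℕ∞ :=
  ⨆ (a ∈ S) (b ∈ S), polDist S a b

/-- Any two points of `S` are connected by a polygonal path within `S`. -/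
def IsPolygonallyConnected (S : Set Plane) : Prop :=
  ∀ a ∈ S, ∀ b ∈ S, ∃ (k : ℕ) (q : Fin (k + 1) → Plane), IsPolygonalPath S a b q

end PolygonalDiameter

open Set Filter Topology

namespace PolygonalDiameter

/-! ### Segments and edges -/

/-! Push the polygon slightly off itself to either side. Consecutive edges do not overlap, so every
vertex `P i` has a vector `w i` strictly to the left of both edges at it (`IsSimple.exists_side`),
and for small `ε > 0` the closed curves with vertices `P i ± ε • w i` miss the polygon
(`IsSimple.eventually_offset_subset`). A point off the polygon looks towards its nearest boundary
point and sees one of the two curves there (`sees_or_sees_neg`). Two points that see the same curve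
are joined by going to the curve, following it the shorter way round and leaving it: at most `n / 2
+ 1` edges on the curve and two more. Hence the complement is covered by two sets, each connected by
such short paths.

A set that is a union of components and misses some point of the complement then lies in one of the
two sets, so interior and exterior obey the bound once both are non-empty
(`exists_pathIn_of_two_sides`). A ray far away gives an exterior point. For an interior point, the
winding number vanishes on unbounded components, but it jumps across an edge and so is nonzero
somewhere. -/

theorem isCompact_segment (x y : Plane) : IsCompact (segment ℝ x y) := by
  rw [segment_eq_image_lineMap]
  exact isCompact_Icc.image AffineMap.lineMap_continuous

theorem notMem_boundary_iff {n : ℕ} {P : Polygon Plane n} {x : Plane} :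
    x ∉ P.boundary ℝ ↔ ∀ i, x ∉ segment ℝ (P i) (P (finRotate n i)) := by
  simp [Polygon.boundary, Polygon.edgeSet, affineSegment_eq_segment]

theorem segment_subset_boundary {n : ℕ} (P : Polygon Plane n) (j : Fin n) :
    segment ℝ (P j) (P (finRotate n j)) ⊆ P.boundary ℝ := fun x hx => by
  by_contra h
  exact notMem_boundary_iff.mp h j hx

theorem isCompact_boundary {n : ℕ} (P : Polygon Plane n) : IsCompact (P.boundary ℝ) :=
  isCompact_iUnion fun i => by
    rw [Polygon.edgeSet, affineSegment_eq_segment]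
    exact isCompact_segment _ _

/-! ### Polygonal paths -/

/-- `a` and `b` are connected by a polygonal path with `k` edges within `S`. -/
def PathIn (S : Set Plane) (k : ℕ) (a b : Plane) : Prop :=
  ∃ q : Fin (k + 1) → Plane, IsPolygonalPath S a b q

theorem PathIn.refl {S : Set Plane} {a : Plane} (ha : a ∈ S) : PathIn S 0 a a :=
  ⟨fun _ => a, rfl, rfl, fun _ => ha, fun i => i.elim0⟩

theorem PathIn.snoc {S : Set Plane} {k : ℕ} {a b c : Plane} (h : PathIn S k a b)
    (hbc : segment ℝ b c ⊆ S) : PathIn S (k + 1) a c := by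
  obtain ⟨q, hq⟩ := h
  refine ⟨Fin.snoc (α := fun _ => Plane) q c, ?_, by simp, ?_, ?_⟩
  · have : (0 : Fin (k + 1 + 1)) = Fin.castSucc 0 := rfl
    rw [this, Fin.snoc_castSucc, hq.source]
  · intro i
    refine Fin.lastCases ?_ (fun j => ?_) i
    · rw [Fin.snoc_last]
      exact hbc (right_mem_segment ℝ b c)
    · rw [Fin.snoc_castSucc]
      exact hq.vertex_mem j
  · intro i
    refine Fin.lastCases ?_ (fun j => ?_) i
    · rw [Fin.snoc_castSucc, Fin.succ_last, Fin.snoc_last, hq.target]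
      exact hbc
    · rw [Fin.snoc_castSucc, Fin.succ_castSucc, Fin.snoc_castSucc]
      exact hq.edge_subset j

theorem PathIn.symm {S : Set Plane} {k : ℕ} {a b : Plane} (h : PathIn S k a b) :
    PathIn S k b a := by
  obtain ⟨q, hq⟩ := h
  refine ⟨fun i => q i.rev, by simpa using hq.target, by simpa using hq.source,
    fun i => hq.vertex_mem _, fun i => ?_⟩
  rw [Fin.rev_castSucc, Fin.rev_succ, segment_symm]
  exact hq.edge_subset _

theorem PathIn.mem_left {S : Set Plane} {k : ℕ} {a b : Plane} (h : PathIn S k a b) : a ∈ S := by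
  obtain ⟨q, hq⟩ := h
  exact hq.source ▸ hq.vertex_mem 0

/-- A polygonal path stays within the connected component of its source. -/
theorem PathIn.connectedComponentIn {S : Set Plane} {k : ℕ} {a b : Plane} (h : PathIn S k a b) :
    PathIn (connectedComponentIn S a) k a b := by
  obtain ⟨q, hq⟩ := h
  have ha : a ∈ S := hq.source ▸ hq.vertex_mem 0
  have key : ∀ i, q i ∈ _root_.connectedComponentIn S a := by
    intro i
    induction i using Fin.induction with
    | zero => rw [hq.source]; exact mem_connectedComponentIn ha
    | succ i ih =>
      rw [connectedComponentIn_eq ih]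
      exact (convex_segment _ _).isPreconnected.subset_connectedComponentIn
        (left_mem_segment ℝ _ _) (hq.edge_subset i) (right_mem_segment ℝ _ _)
  refine ⟨q, hq.source, hq.target, key, fun i => ?_⟩
  rw [connectedComponentIn_eq (key i.castSucc)]
  exact (convex_segment _ _).isPreconnected.subset_connectedComponentIn
    (left_mem_segment ℝ _ _) (hq.edge_subset i)

theorem PathIn.mono {S T : Set Plane} {k : ℕ} {a b : Plane} (h : PathIn S k a b) (hST : S ⊆ T) :
    PathIn T k a b := by
  obtain ⟨q, hq⟩ := h
  exact ⟨q, hq.source, hq.target, fun i => hST (hq.vertex_mem i),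
    fun i => (hq.edge_subset i).trans hST⟩

theorem PathIn.mem_right {S : Set Plane} {k : ℕ} {a b : Plane} (h : PathIn S k a b) : b ∈ S :=
  h.symm.mem_left

theorem poldiam_le {S : Set Plane} {m : ℕ}
    (h : ∀ a ∈ S, ∀ b ∈ S, ∃ k ≤ m, PathIn S k a b) : poldiam S ≤ m := by
  refine iSup₂_le fun a ha => iSup₂_le fun b hb => ?_
  obtain ⟨k, hk, hp⟩ := h a ha b hb
  exact (iInf₂_le k hp).trans (by exact_mod_cast hk)

theorem isPreconnected_of_pathIn {S : Set Plane}
    (h : ∀ a ∈ S, ∀ b ∈ S, ∃ k, PathIn S k a b) : IsPreconnected S := by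
  refine isPreconnected_of_forall_pair fun a ha b hb => ?_
  obtain ⟨k, hp⟩ := h a ha b hb
  exact ⟨_, connectedComponentIn_subset S a, mem_connectedComponentIn ha,
    hp.connectedComponentIn.mem_right, isPreconnected_connectedComponentIn⟩

/-! ### Walking along a closed polygonal curve -/

theorem PathIn.walk {S : Set Plane} {n : ℕ} {c : Fin n → Plane}
    (hc : ∀ i, segment ℝ (c i) (c (finRotate n i)) ⊆ S) {k : ℕ} {a : Plane} {i : Fin n}
    (h : PathIn S k a (c i)) (m : ℕ) : PathIn S (k + m) a (c ((finRotate n)^[m] i)) := by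
  induction m with
  | zero => exact h
  | succ m ih =>
    rw [Function.iterate_succ_apply']
    exact ih.snoc (hc _)

/-- Two points on edges of a closed curve within `S` that are `m` steps apart, each joined by a
segment to a further point. -/
theorem PathIn.of_curve {S : Set Plane} {n : ℕ} {c : Fin n → Plane}
    (hc : ∀ i, segment ℝ (c i) (c (finRotate n i)) ⊆ S) {a b x y : Plane} {i : Fin n} {m : ℕ}
    (hx : x ∈ segment ℝ (c i) (c (finRotate n i))) (hax : segment ℝ a x ⊆ S)
    (hy : y ∈ segment ℝ (c ((finRotate n)^[m] i)) (c (finRotate n ((finRotate n)^[m] i))))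
    (hby : segment ℝ b y ⊆ S) : PathIn S (m + 3) a b := by
  have h1 : PathIn S 1 a x := (PathIn.refl (hax (left_mem_segment ℝ a x))).snoc hax
  rw [segment_symm] at hby
  cases m with
  | zero =>
    exact (h1.snoc (((convex_segment _ _).segment_subset hx hy).trans (hc i))).snoc hby
  | succ m =>
    have h2 := h1.snoc (((convex_segment _ _).segment_subset hx
      (right_mem_segment ℝ _ _)).trans (hc i))
    have h3 := (h2.walk hc m)
    rw [← Function.iterate_succ_apply] at h3
    have h4 := (h3.snoc (((convex_segment _ _).segment_subset
      (left_mem_segment ℝ _ _) hy).trans (hc _))).snoc hby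
    convert h4 using 1
    ring

theorem finRotate_iterate_apply {n : ℕ} (i : Fin (n + 1)) (k : Fin (n + 1)) :
    (finRotate (n + 1))^[k] i = i + k := by
  rw [← finCycle_eq_finRotate_iterate]
  rfl

/-- Two indices of an `n`-cycle are at distance at most `n / 2` in one of the directions. -/
theorem exists_finRotate_iterate {n : ℕ} (i j : Fin n) :
    (∃ m ≤ n / 2, (finRotate n)^[m] i = j) ∨ ∃ m ≤ n / 2, (finRotate n)^[m] j = i := by
  obtain ⟨n, rfl⟩ : ∃ k, n = k + 1 := Nat.exists_eq_succ_of_ne_zero (by have := i.pos; omega)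
  have h1 := finRotate_iterate_apply i (j - i)
  have h2 := finRotate_iterate_apply j (i - j)
  rw [add_sub_cancel] at h1 h2
  by_cases h : ((j - i : Fin (n + 1)) : ℕ) ≤ (n + 1) / 2
  · exact Or.inl ⟨_, h, h1⟩
  · refine Or.inr ⟨_, ?_, h2⟩
    rw [Fin.val_sub] at h ⊢
    have := i.isLt
    have := j.isLt
    rcases le_total (i : ℕ) j with hij | hij
    · rw [show n + 1 - (i : ℕ) + j = (j - i) + (n + 1) by omega, Nat.add_mod_right,
        Nat.mod_eq_of_lt (by omega)] at h
      rw [Nat.mod_eq_of_lt (by omega)]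
      omega
    · rw [show n + 1 - (j : ℕ) + i = (i - j) + (n + 1) by omega, Nat.add_mod_right,
        Nat.mod_eq_of_lt (by omega)]
      rcases eq_or_lt_of_le hij with h0 | h0
      · omega
      · rw [Nat.mod_eq_of_lt (by omega)] at h
        omega

theorem exists_pathIn_of_curve {S : Set Plane} {n : ℕ} {c : Fin n → Plane}
    (hc : ∀ i, segment ℝ (c i) (c (finRotate n i)) ⊆ S) {a b x y : Plane} {i j : Fin n}
    (hx : x ∈ segment ℝ (c i) (c (finRotate n i))) (hax : segment ℝ a x ⊆ S)
    (hy : y ∈ segment ℝ (c j) (c (finRotate n j))) (hby : segment ℝ b y ⊆ S) :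
    ∃ k ≤ n / 2 + 3, PathIn S k a b := by
  rcases exists_finRotate_iterate i j with ⟨m, hm, rfl⟩ | ⟨m, hm, rfl⟩
  · exact ⟨m + 3, by omega, PathIn.of_curve hc hx hax hy hby⟩
  · exact ⟨m + 3, by omega, (PathIn.of_curve hc hy hby hx hax).symm⟩

/-! ### Edges of a simple polygon -/

theorem IsSimple.ne_finRotate {n : ℕ} {P : Polygon Plane n} (hP : IsSimple P) (hn : 3 ≤ n)
    (i : Fin n) : P i ≠ P (finRotate n i) := by
  intro h
  have h1 := hP.injective h
  obtain ⟨n, rfl⟩ : ∃ k, n = k + 2 := ⟨n - 2, by omega⟩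
  have h2 : i ∈ (finRotate (n + 2)).support := by rw [support_finRotate]; simp
  exact (Equiv.Perm.mem_support.mp h2) h1.symm

theorem IsSimple.eq_of_mem_consecutive {n : ℕ} {P : Polygon Plane n} (hP : IsSimple P)
    {i : Fin n} {x : Plane} (h1 : x ∈ segment ℝ (P i) (P (finRotate n i)))
    (h2 : x ∈ segment ℝ (P (finRotate n i)) (P (finRotate n (finRotate n i)))) :
    x = P (finRotate n i) := by
  have h : x ∈ P.edgeSet ℝ i ∩ P.edgeSet ℝ (finRotate n i) := by
    rw [Polygon.edgeSet, Polygon.edgeSet, affineSegment_eq_segment, affineSegment_eq_segment]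
    exact ⟨h1, h2⟩
  rw [hP.consecutive] at h
  exact h

theorem IsSimple.disjoint_segment {n : ℕ} {P : Polygon Plane n} (hP : IsSimple P)
    {i j : Fin n} (h1 : i ≠ j) (h2 : j ≠ finRotate n i) (h3 : i ≠ finRotate n j) :
    Disjoint (segment ℝ (P i) (P (finRotate n i))) (segment ℝ (P j) (P (finRotate n j))) := by
  have := hP.nonconsecutive i j h1 h2 h3
  rwa [Polygon.edgeSet, Polygon.edgeSet, affineSegment_eq_segment, affineSegment_eq_segment]
    at this

/-- Edges meet at most in vertices. Near this midpoint only the `i`-th edge matters, which isolates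
the jump of the winding number. -/
theorem IsSimple.midpoint_notMem {n : ℕ} {P : Polygon Plane n} (hP : IsSimple P) (hn : 3 ≤ n)
    {i j : Fin n} (hj : j ≠ i) :
    midpoint ℝ (P i) (P (finRotate n i)) ∉ segment ℝ (P j) (P (finRotate n j)) := by
  intro hm
  have hi := midpoint_mem_segment (𝕜 := ℝ) (P i) (P (finRotate n i))
  have hne := hP.ne_finRotate hn i
  by_cases h2 : j = finRotate n i
  · subst h2
    have := hP.eq_of_mem_consecutive hi hm
    rw [midpoint_eq_right_iff] at this
    exact hne this
  by_cases h3 : i = finRotate n j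
  · rw [h3] at hi
    have := hP.eq_of_mem_consecutive hm (by rw [← h3]; rwa [← h3] at hi)
    rw [← h3, midpoint_eq_left_iff] at this
    exact hne this
  exact Set.disjoint_left.mp (hP.disjoint_segment hj.symm h2 h3) hi hm

/-! ### The cross product in the plane -/

/-- The cross product (signed area) of two vectors of the plane. -/
noncomputable def cross (u v : Plane) : ℝ := u 0 * v 1 - u 1 * v 0

theorem inner_eq (u v : Plane) : inner ℝ u v = u 0 * v 0 + u 1 * v 1 := by
  simp [PiLp.inner_apply, Fin.sum_univ_two]
  ring

/-- Expansion in the orthogonal frame of `v` and its rotation. It turns "left of an edge" into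
information about inner products with the direction `v` of the nearest point. -/
theorem inner_self_mul_cross (d v w : Plane) : inner ℝ v v * cross d w =
    inner ℝ d v * cross v w + cross d v * inner ℝ w v := by
  simp only [inner_eq, cross]
  ring

/-- Two vectors that do not point in opposite directions have a common strict left side. -/
theorem exists_cross_pos {d d' : Plane} (hd : d ≠ 0) (hd' : d' ≠ 0)
    (h : ∀ k : ℝ, 0 < k → d' ≠ -(k • d)) : ∃ w, 0 < cross d w ∧ 0 < cross d' w := by
  by_cases hc : cross d d' = 0
  · have hdd : 0 < inner ℝ d d := real_inner_self_pos.mpr hd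
    have hdd' : d' = (inner ℝ d' d / inner ℝ d d) • d := by
      rw [eq_comm, div_eq_inv_mul, mul_smul, inv_smul_eq_iff₀ hdd.ne']
      ext i
      simp only [cross, inner_eq] at hc ⊢
      fin_cases i <;> simp
      · linear_combination d 1 * hc
      · linear_combination (-d 0) * hc
    have hpos : 0 < inner ℝ d' d := by
      by_contra! hle
      rcases hle.lt_or_eq with hlt | h0
      · refine h (-(inner ℝ d' d / inner ℝ d d)) ?_ ?_
        · rw [neg_pos]
          exact div_neg_of_neg_of_pos hlt hdd
        · rw [neg_smul, neg_neg]
          exact hdd'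
      · rw [h0, zero_div, zero_smul] at hdd'
        exact hd' hdd'
    refine ⟨!₂[-d 1, d 0], ?_, ?_⟩
    · rw [inner_eq] at hdd
      simp [cross]
      linarith
    · rw [inner_eq] at hpos
      simp [cross]
      linarith
  -- Both `d` and `d'` have cross product `cross d d'` with `d' - d`; the scalar factor makes it a
  -- square.
  · refine ⟨cross d d' • (d' - d), ?_, ?_⟩
    · have : cross d (cross d d' • (d' - d)) = cross d d' ^ 2 := by
        simp [cross]
        ring
      rw [this]
      positivity
    · have : cross d' (cross d d' • (d' - d)) = cross d d' ^ 2 := by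
        simp [cross]
        ring
      rw [this]
      positivity

theorem IsSimple.exists_side {n : ℕ} {P : Polygon Plane n} (hP : IsSimple P) (hn : 3 ≤ n) :
    ∃ w : Fin n → Plane, ∀ i, 0 < cross (P (finRotate n i) - P i) (w i) ∧
      0 < cross (P (finRotate n i) - P i) (w (finRotate n i)) := by
  have hd : ∀ i, P (finRotate n i) - P i ≠ 0 := fun i =>
    sub_ne_zero.mpr (hP.ne_finRotate hn i).symm
  have key : ∀ i, ∃ w, 0 < cross (P (finRotate n i) - P i) w ∧
      0 < cross (P (finRotate n (finRotate n i)) - P (finRotate n i)) w := by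
    intro i
    refine exists_cross_pos (hd i) (hd _) fun k hk h => ?_
    set d := P (finRotate n i) - P i with hdd
    set q := P (finRotate n i) with hq
    -- If the next edge turned straight back, `q - (t * k) • d` would lie on both edges, although
    -- they share only `q`.
    have hmem : ∀ t : ℝ, 0 ≤ t → t ≤ 1 → t * k ≤ 1 → q - (t * k) • d = q := by
      intro t h0 h1 htk
      refine hP.eq_of_mem_consecutive (i := i) ?_ ?_
      · rw [segment_symm, segment_eq_image']
        refine ⟨t * k, ⟨by positivity, htk⟩, ?_⟩
        simp only [hdd, hq]
        module
      · rw [segment_eq_image']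
        refine ⟨t, ⟨h0, h1⟩, ?_⟩
        simp only [← hq, h]
        module
    have ht : 0 < min 1 (1 / k) := lt_min one_pos (by positivity)
    have := hmem (min 1 (1 / k)) ht.le (min_le_left _ _) (by
      calc min 1 (1 / k) * k ≤ 1 / k * k := by gcongr; exact min_le_right _ _
        _ = 1 := by field_simp)
    rw [sub_eq_self, smul_eq_zero] at this
    rcases this with h0 | h0
    · exact (mul_pos ht hk).ne' h0
    · exact hd i h0
  choose u hu using key
  -- `u` is indexed by the edge entering the vertex, hence the shift.
  refine ⟨fun i => u ((finRotate n).symm i), fun i => ⟨?_, ?_⟩⟩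
  · have := (hu ((finRotate n).symm i)).2
    rwa [Equiv.apply_symm_apply] at this
  · have := (hu i).1
    simpa only [Equiv.symm_apply_apply] using this

/-! ### Offset curves -/

/-- Tube lemma: avoiding `F` is an open condition at each parameter, and the parameters form a
compact interval. -/
theorem eventually_segment_subset_compl {F : Set Plane} (hF : IsClosed F) {x y : Plane}
    (hxy : Disjoint (segment ℝ x y) F) {l : Filter ℝ} {f g : ℝ → Plane}
    (hf : Tendsto f l (𝓝 x)) (hg : Tendsto g l (𝓝 y)) :
    ∀ᶠ ε in l, segment ℝ (f ε) (g ε) ⊆ Fᶜ := by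
  have h : ∀ᶠ z : Plane × Plane in 𝓝 (x, y), ∀ t ∈ Icc (0 : ℝ) 1,
      AffineMap.lineMap z.1 z.2 t ∈ Fᶜ := by
    refine isCompact_Icc.eventually_forall_of_forall_eventually fun t ht => ?_
    have hc : Continuous fun z : (Plane × Plane) × ℝ =>
        (AffineMap.lineMap z.1.1 z.1.2 z.2 : Plane) := by
      simp only [AffineMap.lineMap_apply_module]
      fun_prop
    refine hc.continuousAt.eventually (hF.isOpen_compl.mem_nhds ?_)
    apply Set.disjoint_left.mp hxy
    rw [segment_eq_image_lineMap]
    exact mem_image_of_mem _ ht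
  filter_upwards [(hf.prodMk_nhds hg).eventually h] with ε hε
  rw [segment_eq_image_lineMap]
  rintro _ ⟨t, ht, rfl⟩
  exact hε t ht

/-- Near a corner, an offset of the ray in direction `e` avoids the ray in direction `f`. -/
theorem eventually_offset_ne {σ : ℝ} {e f w w' : Plane} (h1 : 0 < σ * cross e w)
    (h2 : 0 < σ * cross e w') (h3 : σ * cross e f ≤ 0 ∨ σ * cross f w < 0) :
    ∀ᶠ ε in 𝓝[>] (0 : ℝ), ∀ s : ℝ, 0 ≤ s → s ≤ 1 → ∀ t : ℝ, 0 ≤ t →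
      s • e + ε • ((1 - s) • w + s • w') ≠ t • f := by
  -- If `f` is not strictly on the offset side of `e`, cross with `e`: the left side becomes
  -- positive, the right side is not. Otherwise cross with `f`, which kills the right side, while
  -- the left side is negative once `ε` is small.
  by_cases hef : σ * cross e f ≤ 0
  · filter_upwards [self_mem_nhdsWithin] with ε hε s hs0 hs1 t ht heq
    have hε : 0 < ε := hε
    have := congrArg (fun z => σ * cross e z) heq
    simp only [cross, PiLp.add_apply, PiLp.smul_apply, smul_eq_mul] at this h1 h2 hef
    have h4 : 0 < (1 - s) * (σ * (e 0 * w 1 - e 1 * w 0)) +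
        s * (σ * (e 0 * w' 1 - e 1 * w' 0)) := by
      rcases hs0.eq_or_lt with rfl | hs
      · simpa using h1
      · have := mul_nonneg (sub_nonneg.mpr hs1) h1.le
        have := mul_pos hs h2
        linarith
    have h5 := mul_pos hε h4
    have h6 := mul_nonneg ht (neg_nonneg.mpr hef)
    linarith
  · have h3 : σ * cross f w < 0 := h3.resolve_left hef
    push Not at hef
    have hsmall : ∀ᶠ ε in 𝓝[>] (0 : ℝ), ε * (σ * cross f w') < σ * cross e f := by
      have : Tendsto (fun ε : ℝ => ε * (σ * cross f w')) (𝓝[>] 0) (𝓝 0) := by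
        have := ((continuous_id (X := ℝ)).mul_const (σ * cross f w')).tendsto 0
        simp only [id, zero_mul] at this
        exact this.mono_left nhdsWithin_le_nhds
      exact this.eventually_lt_const hef
    filter_upwards [self_mem_nhdsWithin, hsmall] with ε hε hsm s hs0 hs1 t ht heq
    have hε : 0 < ε := hε
    have := congrArg (fun z => σ * cross f z) heq
    simp only [cross, PiLp.add_apply, PiLp.smul_apply, smul_eq_mul] at this h3 hsm
    have h4 : s * (ε * (σ * (f 0 * w' 1 - f 1 * w' 0)) - σ * (e 0 * f 1 - e 1 * f 0)) +
        ε * ((1 - s) * (σ * (f 0 * w 1 - f 1 * w 0))) < 0 := by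
      rcases hs0.eq_or_lt with rfl | hs
      · have := mul_neg_of_pos_of_neg hε h3
        simpa using this
      · have := mul_neg_of_pos_of_neg hs (sub_neg.mpr hsm)
        have := mul_nonneg hε.le (mul_nonneg (sub_nonneg.mpr hs1) (neg_pos.mpr h3).le)
        linarith
    linarith

/-- The curve with vertices `P i + ε • w i`. -/
noncomputable def offset {n : ℕ} (P : Polygon Plane n) (w : Fin n → Plane) (ε : ℝ)
    (i : Fin n) : Plane := P i + ε • w i

theorem tendsto_offset {n : ℕ} (P : Polygon Plane n) (w : Fin n → Plane) (i : Fin n) :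
    Tendsto (fun ε => offset P w ε i) (𝓝[>] 0) (𝓝 (P i)) := by
  have h : Continuous fun ε => offset P w ε i := by
    unfold offset
    fun_prop
  have := h.tendsto 0
  simp only [offset, zero_smul, add_zero] at this
  exact this.mono_left nhdsWithin_le_nhds

/-- The sign `σ` treats both sides at once. An offset edge stays strictly to one side of its own
edge, avoids the adjacent edges by the corner estimate `eventually_offset_ne`, and avoids the others
because they lie at positive distance. -/
theorem IsSimple.eventually_offset_subset {n : ℕ} {P : Polygon Plane n} (hP : IsSimple P)
    {w : Fin n → Plane} {σ : ℝ}
    (hw : ∀ i, 0 < σ * cross (P (finRotate n i) - P i) (w i) ∧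
      0 < σ * cross (P (finRotate n i) - P i) (w (finRotate n i))) :
    ∀ᶠ ε in 𝓝[>] (0 : ℝ), ∀ i,
      segment ℝ (offset P w ε i) (offset P w ε (finRotate n i)) ⊆ (P.boundary ℝ)ᶜ := by
  have key : ∀ i j, ∀ᶠ ε in 𝓝[>] (0 : ℝ),
      segment ℝ (offset P w ε i) (offset P w ε (finRotate n i)) ⊆
        (segment ℝ (P j) (P (finRotate n j)))ᶜ := by
    intro i j
    by_cases h1 : i = j
    · subst h1
      have := eventually_offset_ne (f := P (finRotate n i) - P i) (hw i).1 (hw i).2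
        (Or.inl (by simp [cross, mul_comm]))
      filter_upwards [this] with ε hε
      rw [segment_eq_image, segment_eq_image]
      rintro _ ⟨s, hs, rfl⟩ ⟨t, ht, heq⟩
      refine hε s hs.1 hs.2 t ht.1 ?_
      simp only [offset] at heq
      rw [← sub_eq_zero] at heq ⊢
      rw [← neg_eq_zero, ← heq]
      module
    by_cases h2 : j = finRotate n i
    · subst h2
      -- At the common vertex the `i`-th edge is traversed backwards, which reverses the sign of the
      -- cross product and swaps `s` with `1 - s`.
      have := eventually_offset_ne (σ := -σ) (e := -(P (finRotate n i) - P i))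
        (f := P (finRotate n (finRotate n i)) - P (finRotate n i))
        (w := w (finRotate n i)) (w' := w i)
        (by have := (hw i).2; simp only [cross, PiLp.neg_apply] at this ⊢; linarith)
        (by have := (hw i).1; simp only [cross, PiLp.neg_apply] at this ⊢; linarith)
        (Or.inr (by have := (hw (finRotate n i)).1; linarith))
      filter_upwards [this] with ε hε
      rw [segment_eq_image, segment_eq_image]
      rintro _ ⟨s, hs, rfl⟩ ⟨t, ht, heq⟩
      refine hε (1 - s) (by linarith [hs.2]) (by linarith [hs.1]) t ht.1 ?_
      simp only [offset] at heq
      rw [← sub_eq_zero] at heq ⊢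
      rw [← neg_eq_zero, ← heq]
      module
    by_cases h3 : i = finRotate n j
    · subst h3
      have := eventually_offset_ne (f := -(P (finRotate n j) - P j)) (hw (finRotate n j)).1
        (hw (finRotate n j)).2
        (Or.inr (by have := (hw j).2; simp only [cross, PiLp.neg_apply] at this ⊢; linarith))
      filter_upwards [this] with ε hε
      rw [segment_eq_image, segment_eq_image]
      rintro _ ⟨s, hs, rfl⟩ ⟨t, ht, heq⟩
      refine hε s hs.1 hs.2 (1 - t) (by linarith [ht.2]) ?_
      simp only [offset] at heq
      rw [← sub_eq_zero] at heq ⊢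
      rw [← neg_eq_zero, ← heq]
      module
    exact eventually_segment_subset_compl (isCompact_segment _ _).isClosed
      (hP.disjoint_segment h1 h2 h3) (tendsto_offset P w i) (tendsto_offset P w _)
  filter_upwards [eventually_all.mpr fun i => eventually_all.mpr (key i)] with ε hε i x hx
  exact notMem_boundary_iff.mpr fun j => hε i j hx

/-! ### Every point sees an offset curve -/

/-- For small `ε`, the point `a` is joined within the complement of `P` by a segment to a point
of the curve with vertices `P i + ε • w i`. -/
def Sees {n : ℕ} (P : Polygon Plane n) (w : Fin n → Plane) (a : Plane) : Prop :=
  ∃ i, ∀ᶠ ε in 𝓝[>] (0 : ℝ),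
    ∃ x ∈ segment ℝ (offset P w ε i) (offset P w ε (finRotate n i)),
      segment ℝ a x ⊆ (P.boundary ℝ)ᶜ

theorem inner_le_zero_of_dist_le {K : Set Plane} (hK : Convex ℝ K) {a q : Plane} (hq : q ∈ K)
    (h : ∀ x ∈ K, dist a q ≤ dist a x) {x : Plane} (hx : x ∈ K) :
    inner ℝ (a - q) (x - q) ≤ 0 := by
  have : Nonempty K := ⟨⟨q, hq⟩⟩
  refine (norm_eq_iInf_iff_real_inner_le_zero hK hq).mp ?_ x hx
  refine le_antisymm (le_ciInf fun w => ?_) ?_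
  · simpa only [dist_eq_norm] using h w w.2
  · exact ciInf_le (f := fun w : K => ‖a - w‖)
      ⟨0, by rintro _ ⟨w, rfl⟩; exact norm_nonneg _⟩ ⟨q, hq⟩

theorem eq_of_mem_segment_of_dist_le {a q x : Plane} (hx : x ∈ segment ℝ a q)
    (h : dist a q ≤ dist a x) : x = q := by
  have := dist_add_dist_of_mem_segment hx
  exact dist_le_zero.mp (by linarith)

/-- Edges through `q` lie in the half-plane of `x` with `inner ℝ (a - q) (x - q) ≤ 0`, and the
segment stays strictly outside it. Any other edge misses `segment ℝ a q`, since `q` is its only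
boundary point, so it also misses small perturbations. -/
theorem eventually_segment_subset_of_nearest {n : ℕ} {P : Polygon Plane n} {a q : Plane}
    (ha : a ∉ P.boundary ℝ) (hmin : ∀ x ∈ P.boundary ℝ, dist a q ≤ dist a x)
    {W : Plane} (hW : 0 < inner ℝ (a - q) W) :
    ∀ᶠ ε in 𝓝[>] (0 : ℝ), segment ℝ a (q + ε • W) ⊆ (P.boundary ℝ)ᶜ := by
  have hsub := segment_subset_boundary P
  have key : ∀ j, ∀ᶠ ε in 𝓝[>] (0 : ℝ), segment ℝ a (q + ε • W) ⊆
      (segment ℝ (P j) (P (finRotate n j)))ᶜ := by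
    intro j
    by_cases hqj : q ∈ segment ℝ (P j) (P (finRotate n j))
    · have haq : a - q ≠ 0 := by
        rw [sub_ne_zero]
        rintro rfl
        exact ha (hsub j hqj)
      filter_upwards [self_mem_nhdsWithin] with ε hε x hx hxj
      have hε : 0 < ε := hε
      have h1 := inner_le_zero_of_dist_le (convex_segment _ _) hqj
        (fun y hy => hmin y (hsub j hy)) hxj
      rw [segment_eq_image] at hx
      obtain ⟨t, ht, rfl⟩ := hx
      have h2 : (1 - t) • a + t • (q + ε • W) - q = (1 - t) • (a - q) + (t * ε) • W := by
        module
      simp only [h2, inner_add_right, inner_smul_right] at h1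
      have h3 : 0 < inner ℝ (a - q) (a - q) := real_inner_self_pos.mpr haq
      rcases ht.1.eq_or_lt with rfl | ht0
      · simp at h1
        exact absurd h1 haq
      · have := mul_nonneg (sub_nonneg.mpr ht.2) h3.le
        have := mul_pos (mul_pos ht0 hε) hW
        linarith
    · refine eventually_segment_subset_compl (isCompact_segment _ _).isClosed (x := a) (y := q)
        ?_ tendsto_const_nhds ?_
      · rw [Set.disjoint_left]
        intro x hx hxj
        rw [eq_of_mem_segment_of_dist_le hx (hmin x (hsub j hxj))] at hxj
        exact hqj hxj
      · have h : Continuous fun ε : ℝ => q + ε • W := by fun_prop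
        have := h.tendsto 0
        simp only [zero_smul, add_zero] at this
        exact this.mono_left nhdsWithin_le_nhds
  filter_upwards [eventually_all.mpr key] with ε hε x hx
  exact notMem_boundary_iff.mpr fun j => hε j hx

/-- If the nearest point is `q = s • P i + t • P (finRotate n i)`, then `q ± ε • W` with the same
weights lies on the offset curves. Only `inner ℝ W (a - q) ≠ 0` is needed; its sign selects the
curve. -/
theorem sees_or_sees_neg {n : ℕ} (hn : 0 < n) {P : Polygon Plane n} {w : Fin n → Plane}
    (hw : ∀ i, 0 < cross (P (finRotate n i) - P i) (w i) ∧
      0 < cross (P (finRotate n i) - P i) (w (finRotate n i)))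
    {a : Plane} (ha : a ∉ P.boundary ℝ) : Sees P w a ∨ Sees P (-w) a := by
  have hsub := segment_subset_boundary P
  have hne : (P.boundary ℝ).Nonempty := ⟨P ⟨0, hn⟩, hsub _ (left_mem_segment ℝ _ _)⟩
  obtain ⟨q, hqP, hmin⟩ := (isCompact_boundary P).exists_isMinOn hne (f := fun x => dist a x) (by fun_prop)
  have hmin : ∀ x ∈ P.boundary ℝ, dist a q ≤ dist a x := fun x hx => hmin hx
  have haq : 0 < inner ℝ (a - q) (a - q) := by
    refine real_inner_self_pos.mpr (sub_ne_zero.mpr ?_)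
    rintro rfl
    exact ha hqP
  have hnear : ∀ {j}, q ∈ segment ℝ (P j) (P (finRotate n j)) →
      ∀ {x}, x ∈ segment ℝ (P j) (P (finRotate n j)) → inner ℝ (x - q) (a - q) ≤ 0 := by
    intro j hq x hx
    rw [real_inner_comm]
    exact inner_le_zero_of_dist_le (convex_segment _ _) hq (fun y hy => hmin y (hsub j hy)) hx
  -- If the inner product were zero, `inner_self_mul_cross` would force the incoming and outgoing
  -- directions to have nonzero inner products of the same sign with `a - q`; as `q` is nearest, the
  -- former is `≥ 0` and the latter `≤ 0`.
  have hvert : ∀ j, q = P (finRotate n j) → inner ℝ (w (finRotate n j)) (a - q) ≠ 0 := by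
    intro j hq h0
    have h1 := hnear (j := j) (hq ▸ right_mem_segment ℝ _ _) (left_mem_segment ℝ _ _)
    have h2 := hnear (j := finRotate n j) (hq ▸ left_mem_segment ℝ _ _) (right_mem_segment ℝ _ _)
    have c1 := mul_pos haq (hw j).2
    have c2 := mul_pos haq (hw (finRotate n j)).1
    rw [inner_self_mul_cross, h0, mul_zero, add_zero, ← hq] at c1 c2
    rw [← neg_sub q, inner_neg_left] at h1
    rcases le_total 0 (cross (a - q) (w (finRotate n j))) with h | h
    · linarith [mul_nonneg (neg_nonneg.mpr h2) h]
    · linarith [mul_nonneg (neg_le_neg_iff.mp (by simpa using h1) : 0 ≤ inner ℝ (q - P j) (a - q))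
        (neg_nonneg.mpr h)]
  obtain ⟨i, hqi⟩ : ∃ i, q ∈ segment ℝ (P i) (P (finRotate n i)) := by
    by_contra! h
    exact notMem_boundary_iff.mpr h hqP
  obtain ⟨s, t, hs, ht, hst, hq⟩ := hqi
  set W := s • w i + t • w (finRotate n i) with hWdef
  have hW : inner ℝ W (a - q) ≠ 0 := by
    rcases hs.eq_or_lt with rfl | hs
    · rw [zero_add] at hst
      subst hst
      simp only [zero_smul, one_smul, zero_add] at hq
      simpa [hWdef] using hvert i hq.symm
    rcases ht.eq_or_lt with rfl | ht
    · rw [add_zero] at hst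
      subst hst
      simp only [zero_smul, one_smul, add_zero] at hq
      have := hvert ((finRotate n).symm i) (by rw [Equiv.apply_symm_apply, hq])
      rw [Equiv.apply_symm_apply] at this
      simpa [hWdef] using this
    have hqi : q ∈ segment ℝ (P i) (P (finRotate n i)) := ⟨s, t, hs.le, ht.le, hst, hq⟩
    have h1 := hnear hqi (left_mem_segment ℝ _ _)
    have h2 := hnear hqi (right_mem_segment ℝ _ _)
    have hs' : s = 1 - t := by linarith
    have e1 : P i - q = -(t • (P (finRotate n i) - P i)) := by
      rw [← hq, hs']
      module
    have e2 : P (finRotate n i) - q = s • (P (finRotate n i) - P i) := by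
      rw [← hq, hs']
      module
    rw [e1, inner_neg_left, real_inner_smul_left, neg_nonpos] at h1
    rw [e2, real_inner_smul_left] at h2
    -- Inside an edge, `a - q` is perpendicular to it, whereas `W` is strictly to its left and so
    -- cannot also be perpendicular to `a - q`.
    have h0 : inner ℝ (P (finRotate n i) - P i) (a - q) = 0 :=
      le_antisymm (nonpos_of_mul_nonpos_right h2 hs) (nonneg_of_mul_nonneg_right h1 ht)
    intro hW0
    have hc : 0 < cross (P (finRotate n i) - P i) W := by
      have c1 := mul_pos hs (hw i).1
      have c2 := mul_pos ht (hw i).2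
      simp only [hWdef, cross, PiLp.add_apply, PiLp.smul_apply, smul_eq_mul] at c1 c2 ⊢
      linarith
    have := mul_pos haq hc
    rw [inner_self_mul_cross, h0, hW0] at this
    simp at this
  have hmem : ∀ u : Fin n → Plane, ∀ ε : ℝ, q + ε • (s • u i + t • u (finRotate n i)) ∈
      segment ℝ (offset P u ε i) (offset P u ε (finRotate n i)) := by
    intro u ε
    refine ⟨s, t, hs, ht, hst, ?_⟩
    simp only [offset, ← hq]
    module
  rcases hW.lt_or_gt with hlt | hgt
  · right
    refine ⟨i, ?_⟩
    have : 0 < inner ℝ (a - q) (s • (-w) i + t • (-w) (finRotate n i)) := by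
      have e : s • (-w) i + t • (-w) (finRotate n i) = -W := by
        simp only [hWdef, Pi.neg_apply]
        module
      rw [e, inner_neg_right, real_inner_comm]
      linarith
    filter_upwards [eventually_segment_subset_of_nearest ha hmin this] with ε hε
    exact ⟨_, hmem (-w) ε, hε⟩
  · left
    refine ⟨i, ?_⟩
    have : 0 < inner ℝ (a - q) (s • w i + t • w (finRotate n i)) := by
      rw [real_inner_comm]
      exact hgt
    filter_upwards [eventually_segment_subset_of_nearest ha hmin this] with ε hε
    exact ⟨_, hmem w ε, hε⟩

theorem IsSimple.exists_pathIn_of_sees {n : ℕ} {P : Polygon Plane n} (hP : IsSimple P)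
    {w : Fin n → Plane} {σ : ℝ}
    (hw : ∀ i, 0 < σ * cross (P (finRotate n i) - P i) (w i) ∧
      0 < σ * cross (P (finRotate n i) - P i) (w (finRotate n i)))
    {a b : Plane} (ha : Sees P w a) (hb : Sees P w b) :
    ∃ k ≤ n / 2 + 3, PathIn (P.boundary ℝ)ᶜ k a b := by
  obtain ⟨i, ha⟩ := ha
  obtain ⟨j, hb⟩ := hb
  obtain ⟨ε, hε, ⟨x, hx, hax⟩, y, hy, hby⟩ :=
    ((hP.eventually_offset_subset hw).and (ha.and hb)).exists
  exact exists_pathIn_of_curve hε hx hax hy hby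

/-- The complement of a simple polygon is the union of two polygonally connected sets. -/
theorem IsSimple.exists_two_sides {n : ℕ} {P : Polygon Plane n} (hP : IsSimple P) (hn : 3 ≤ n) :
    ∃ A B : Set Plane, (P.boundary ℝ)ᶜ ⊆ A ∪ B ∧
      (∀ a ∈ A, ∀ b ∈ A, ∃ k ≤ n / 2 + 3, PathIn (P.boundary ℝ)ᶜ k a b) ∧
      (∀ a ∈ B, ∀ b ∈ B, ∃ k ≤ n / 2 + 3, PathIn (P.boundary ℝ)ᶜ k a b) := by
  obtain ⟨w, hw⟩ := hP.exists_side hn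
  refine ⟨{a | Sees P w a}, {a | Sees P (-w) a}, fun a ha => sees_or_sees_neg (by omega) hw ha,
    fun a ha b hb => hP.exists_pathIn_of_sees (σ := 1) (by simpa using hw) ha hb,
    fun a ha b hb => hP.exists_pathIn_of_sees (σ := -1) (fun i => ?_) ha hb⟩
  have := hw i
  simp only [cross, Pi.neg_apply, PiLp.neg_apply] at this ⊢
  exact ⟨by linarith [this.1], by linarith [this.2]⟩

/-! ### The winding number of a closed polygon -/

/-- The plane as the complex numbers. -/
noncomputable def toComplex (x : Plane) : ℂ := ⟨x 0, x 1⟩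

@[simp] theorem toComplex_re (x : Plane) : (toComplex x).re = x 0 := rfl

@[simp] theorem toComplex_im (x : Plane) : (toComplex x).im = x 1 := rfl

theorem toComplex_injective : Function.Injective toComplex := by
  intro x y h
  ext i
  fin_cases i
  · exact congrArg Complex.re h
  · exact congrArg Complex.im h

theorem norm_toComplex (x : Plane) : ‖toComplex x‖ = ‖x‖ := by
  rw [Complex.norm_eq_sqrt_sq_add_sq, EuclideanSpace.norm_eq]
  simp

theorem toComplex_add (x y : Plane) : toComplex (x + y) = toComplex x + toComplex y := by
  apply Complex.ext <;> simp

theorem toComplex_smul (r : ℝ) (x : Plane) : toComplex (r • x) = r * toComplex x := by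
  apply Complex.ext <;> simp

theorem continuous_toComplex : Continuous toComplex := by
  have : toComplex = fun x : Plane => ((x 0 : ℝ) : ℂ) + (x 1 : ℝ) * Complex.I := by
    funext x
    apply Complex.ext <;> simp
  rw [this]
  fun_prop

/-- The quotient whose argument is the angle under which the segment from `p` to `p'` is seen
from `x`. -/
noncomputable def viewRatio (p p' x : Plane) : ℂ :=
  (toComplex p' - toComplex x) / (toComplex p - toComplex x)

theorem viewRatio_mem_slitPlane {p p' x : Plane} (h : x ∉ segment ℝ p p') :
    viewRatio p p' x ∈ Complex.slitPlane := by
  by_contra hz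
  apply h
  rw [Complex.mem_slitPlane_iff, not_or, not_lt, not_not] at hz
  by_cases hp : toComplex p = toComplex x
  · rw [toComplex_injective hp]
    exact left_mem_segment ℝ _ _
  set r := (viewRatio p p' x).re with hr
  have hz' : viewRatio p p' x = (r : ℂ) := Complex.ext rfl hz.2
  rw [viewRatio, div_eq_iff (sub_ne_zero.mpr hp)] at hz'
  have h1 : (0 : ℝ) < 1 - r := by linarith [hz.1]
  -- The weights come from solving `p' - x = r (p - x)` for `x`, where `r ≤ 0`.
  refine ⟨-r / (1 - r), 1 / (1 - r), div_nonneg (by linarith [hz.1]) h1.le, by positivity, ?_, ?_⟩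
  · field_simp
    ring
  · apply toComplex_injective
    rw [toComplex_add, toComplex_smul, toComplex_smul]
    have h2 : (1 - r : ℂ) ≠ 0 := by exact_mod_cast h1.ne'
    push_cast
    field_simp
    linear_combination hz'

theorem continuousAt_arg_viewRatio {p p' x : Plane} (h : x ∉ segment ℝ p p') :
    ContinuousAt (fun y => (viewRatio p p' y).arg) x := by
  refine (Complex.continuousAt_arg (viewRatio_mem_slitPlane h)).comp' ?_
  have hp : toComplex p - toComplex x ≠ 0 := by
    rw [sub_ne_zero]
    intro hp
    rw [toComplex_injective hp] at h
    exact h (left_mem_segment ℝ _ _)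
  exact (continuousAt_const.sub continuous_toComplex.continuousAt).div
    (continuousAt_const.sub continuous_toComplex.continuousAt) hp

/-- The ratio equals `1 + (p' - p) / (p - y)`, which tends to `1`. -/
theorem tendsto_arg_viewRatio_cobounded (p p' : Plane) :
    Tendsto (fun y => (viewRatio p p' y).arg) (Bornology.cobounded Plane) (𝓝 0) := by
  have h1 : Tendsto (fun y : Plane => toComplex p - toComplex y) (Bornology.cobounded Plane)
      (Bornology.cobounded ℂ) := by
    rw [← tendsto_norm_atTop_iff_cobounded]
    have h := tendsto_atTop_add_const_right _ (-‖toComplex p‖)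
      (tendsto_norm_cobounded_atTop (E := Plane))
    refine tendsto_atTop_mono (fun y => ?_) h
    have := norm_sub_norm_le (toComplex y) (toComplex p)
    rw [norm_toComplex y, norm_sub_rev] at this
    linarith
  have h2 : Tendsto (fun y => viewRatio p p' y) (Bornology.cobounded Plane) (𝓝 1) := by
    have h3 := ((tendsto_inv₀_cobounded (α := ℂ)).comp h1).const_mul (toComplex p' - toComplex p)
    have h4 := h3.const_add 1
    rw [mul_zero, add_zero] at h4
    refine h4.congr' ?_
    filter_upwards [h1.eventually (Bornology.eventually_ne_cobounded (0 : ℂ))] with y hy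
    rw [viewRatio, Function.comp_apply]
    field_simp
    ring
  have h5 := (Complex.continuousAt_arg Complex.one_mem_slitPlane).tendsto.comp h2
  rwa [Complex.arg_one] at h5

/-- `2π` times the winding number of the closed polygon `P` around `x`. -/
noncomputable def winding {n : ℕ} (P : Polygon Plane n) (x : Plane) : ℝ :=
  ∑ i, (viewRatio (P i) (P (finRotate n i)) x).arg

/-- The view ratios multiply to `1` around the closed polygon, so the sum of their arguments
exponentiates to `1`. -/
theorem winding_eq_int_mul {n : ℕ} {P : Polygon Plane n} {x : Plane} (hx : x ∉ P.boundary ℝ) :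
    ∃ m : ℤ, winding P x = m * (2 * Real.pi) := by
  rw [notMem_boundary_iff] at hx
  have hp : ∀ i, toComplex (P i) - toComplex x ≠ 0 := fun i => by
    rw [sub_ne_zero]
    intro h
    have := hx i
    rw [toComplex_injective h] at this
    exact this (left_mem_segment ℝ _ _)
  have hprod : ∏ i, viewRatio (P i) (P (finRotate n i)) x = 1 := by
    simp only [viewRatio]
    rw [Finset.prod_div_distrib,
      Equiv.prod_comp (finRotate n) (fun i => toComplex (P i) - toComplex x),
      div_self (Finset.prod_ne_zero_iff.mpr fun i _ => hp i)]
  have hexp : Complex.exp (winding P x * Complex.I) = 1 := by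
    have h1 : ∏ i, ((‖viewRatio (P i) (P (finRotate n i)) x‖ : ℂ) *
        Complex.exp ((viewRatio (P i) (P (finRotate n i)) x).arg * Complex.I)) = 1 := by
      simpa only [Complex.norm_mul_exp_arg_mul_I] using hprod
    rw [Finset.prod_mul_distrib, ← Complex.ofReal_prod, ← norm_prod, hprod, norm_one,
      Complex.ofReal_one, one_mul, ← Complex.exp_sum] at h1
    rw [winding, Complex.ofReal_sum, Finset.sum_mul, h1]
  obtain ⟨m, hm⟩ := Complex.exp_eq_one_iff.mp hexp
  refine ⟨m, ?_⟩
  have := congrArg Complex.im hm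
  simpa using this

theorem continuousOn_winding {n : ℕ} (P : Polygon Plane n) :
    ContinuousOn (winding P) (P.boundary ℝ)ᶜ := by
  intro x hx
  have hx' := notMem_boundary_iff.mp hx
  exact (tendsto_finsetSum _ fun i _ =>
    (continuousAt_arg_viewRatio (hx' i)).tendsto).mono_left nhdsWithin_le_nhds

theorem tendsto_winding_cobounded {n : ℕ} (P : Polygon Plane n) :
    Tendsto (winding P) (Bornology.cobounded Plane) (𝓝 0) := by
  have := tendsto_finsetSum Finset.univ fun i _ =>
    tendsto_arg_viewRatio_cobounded (P i) (P (finRotate n i))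
  rw [Finset.sum_const_zero] at this
  exact this

/-- The winding number vanishes on unbounded components. -/
theorem winding_eq_zero_of_mem_outside {n : ℕ} {P : Polygon Plane n} {x : Plane}
    (hx : x ∈ outside P) : winding P x = 0 := by
  by_contra h0
  have hpi := Real.pi_pos
  obtain ⟨y, hy, hyx⟩ : ∃ y ∈ connectedComponentIn (P.boundary ℝ)ᶜ x, |winding P y| < Real.pi := by
    by_contra! hcon
    apply hx.2
    have h1 : ∀ᶠ y in Bornology.cobounded Plane, |winding P y| < Real.pi := by
      have := (tendsto_winding_cobounded P).abs
      rw [abs_zero] at this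
      exact this.eventually_lt_const hpi
    rw [← Bornology.isCobounded_compl_iff]
    filter_upwards [h1] with y hy hy'
    exact absurd hy (not_lt.mpr (hcon y hy'))
  have hsub := connectedComponentIn_subset (P.boundary ℝ)ᶜ x
  have hxm := mem_connectedComponentIn (F := (P.boundary ℝ)ᶜ) hx.1
  have hxx : Real.pi ≤ |winding P x| := by
    obtain ⟨m, hm⟩ := winding_eq_int_mul hx.1
    have hm0 : m ≠ 0 := by
      rintro rfl
      simp [hm] at h0
    rw [hm, abs_mul, abs_of_pos (by positivity : 0 < 2 * Real.pi)]
    have : (1 : ℝ) ≤ |(m : ℝ)| := by exact_mod_cast Int.one_le_abs hm0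
    nlinarith
  -- Between a value below `π` and one of at least `π`, the absolute value `π` is attained, which is
  -- no multiple of `2π`.
  obtain ⟨z, hz, hzv⟩ := isPreconnected_connectedComponentIn.intermediate_value hy hxm
    ((continuousOn_winding P).mono hsub).abs ⟨hyx.le, hxx⟩
  obtain ⟨m, hm⟩ := winding_eq_int_mul (hsub hz)
  replace hzv : |winding P z| = Real.pi := hzv
  rw [hm, abs_mul, abs_of_pos (by positivity : 0 < 2 * Real.pi)] at hzv
  have h2 : |(m : ℝ)| * 2 = 1 := by
    apply mul_right_cancel₀ hpi.ne'
    linarith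
  have h3 : |m| * 2 = 1 := by exact_mod_cast h2
  omega

/-! ### The jump of the winding number across an edge -/

/-- Rotation by a right angle. -/
noncomputable def rot (v : Plane) : Plane := !₂[-v 1, v 0]

theorem toComplex_rot (v : Plane) : toComplex (rot v) = Complex.I * toComplex v := by
  apply Complex.ext <;> simp [rot]

/-- The points of the perpendicular bisector of the segment from `p` to `p'`. -/
noncomputable def bisectorPoint (p p' : Plane) (ε : ℝ) : Plane :=
  midpoint ℝ p p' + ε • rot (p' - p)

theorem toComplex_bisectorPoint (p p' : Plane) (ε : ℝ) : toComplex (bisectorPoint p p' ε) =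
    (toComplex p + toComplex p') / 2 + ε * Complex.I * (toComplex p' - toComplex p) := by
  have h : toComplex (p' - p) = toComplex p' - toComplex p := by apply Complex.ext <;> simp
  rw [bisectorPoint, midpoint_eq_smul_add, toComplex_add, toComplex_smul, toComplex_smul,
    toComplex_rot, toComplex_add, h]
  push_cast [invOf_eq_inv]
  ring

/-- The ratio is `-(1/2 - εi) / (1/2 + εi)`: near `-1` for small `ε`, above or below the real axis
according to the sign of `ε`. -/
theorem viewRatio_bisectorPoint {p p' : Plane} (hp : p ≠ p') (ε : ℝ) :
    viewRatio p p' (bisectorPoint p p' ε) =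
      ((4 * ε ^ 2 - 1) / (4 * ε ^ 2 + 1) : ℝ) + (4 * ε / (4 * ε ^ 2 + 1) : ℝ) * Complex.I := by
  have hd : toComplex p' - toComplex p ≠ 0 :=
    sub_ne_zero.mpr fun h => hp (toComplex_injective h).symm
  have h1 : toComplex p - toComplex (bisectorPoint p p' ε) =
      -(1 / 2 + ε * Complex.I) * (toComplex p' - toComplex p) := by
    rw [toComplex_bisectorPoint]
    ring
  have h2 : toComplex p' - toComplex (bisectorPoint p p' ε) =
      (1 / 2 - ε * Complex.I) * (toComplex p' - toComplex p) := by
    rw [toComplex_bisectorPoint]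
    ring
  have h3 : -(1 / 2 + ε * Complex.I) ≠ 0 := by
    intro h
    have := congrArg Complex.re h
    norm_num at this
  have h4 : (4 * ε ^ 2 + 1 : ℂ) ≠ 0 := by
    have : (4 * ε ^ 2 + 1 : ℝ) ≠ 0 := by positivity
    exact_mod_cast this
  rw [viewRatio, h1, h2, mul_div_mul_right _ _ hd, div_eq_iff h3]
  push_cast
  rw [div_mul_eq_mul_div _ _ Complex.I, ← add_div, div_mul_eq_mul_div, eq_div_iff h4]
  linear_combination (4 * (ε : ℂ) ^ 2) * Complex.I_sq

theorem pi_div_two_lt_arg_viewRatio {p p' : Plane} (hp : p ≠ p') {ε : ℝ} (h0 : 0 < ε)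
    (h1 : ε < 1 / 2) : Real.pi / 2 < (viewRatio p p' (bisectorPoint p p' ε)).arg := by
  rw [← not_le, Complex.arg_le_pi_div_two_iff, viewRatio_bisectorPoint hp]
  have h2 : (4 * ε ^ 2 - 1) / (4 * ε ^ 2 + 1) < 0 :=
    div_neg_of_neg_of_pos (by nlinarith) (by positivity)
  have h3 : 0 < 4 * ε / (4 * ε ^ 2 + 1) := by positivity
  simp only [Complex.add_re, Complex.ofReal_re, Complex.re_ofReal_mul, Complex.I_re, mul_zero,
    add_zero, Complex.add_im, Complex.ofReal_im, Complex.im_ofReal_mul, Complex.I_im, mul_one,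
    zero_add]
  rintro (h | h) <;> linarith

theorem arg_viewRatio_lt_neg_pi_div_two {p p' : Plane} (hp : p ≠ p') {ε : ℝ} (h0 : 0 < ε)
    (h1 : ε < 1 / 2) : (viewRatio p p' (bisectorPoint p p' (-ε))).arg < -(Real.pi / 2) := by
  rw [← not_le, Complex.neg_pi_div_two_le_arg_iff, viewRatio_bisectorPoint hp]
  have h2 : (4 * (-ε) ^ 2 - 1) / (4 * (-ε) ^ 2 + 1) < 0 :=
    div_neg_of_neg_of_pos (by nlinarith) (by positivity)
  have h3 : 4 * (-ε) / (4 * (-ε) ^ 2 + 1) < 0 :=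
    div_neg_of_neg_of_pos (by linarith) (by positivity)
  simp only [Complex.add_re, Complex.ofReal_re, Complex.re_ofReal_mul, Complex.I_re, mul_zero,
    add_zero, Complex.add_im, Complex.ofReal_im, Complex.im_ofReal_mul, Complex.I_im, mul_one,
    zero_add]
  rintro (h | h) <;> linarith

theorem bisectorPoint_notMem_segment {p p' : Plane} (hp : p ≠ p') {ε : ℝ} (h0 : ε ≠ 0) :
    bisectorPoint p p' ε ∉ segment ℝ p p' := by
  rintro ⟨a, b, -, -, hab, h⟩
  have hd : toComplex p' - toComplex p ≠ 0 :=
    sub_ne_zero.mpr fun h => hp (toComplex_injective h).symm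
  have h1 := toComplex_bisectorPoint p p' ε
  rw [← h, toComplex_add, toComplex_smul, toComplex_smul] at h1
  have h2 : ((b - 1 / 2 : ℝ) : ℂ) = ε * Complex.I := by
    apply mul_right_cancel₀ hd
    have hab' : (a : ℂ) = 1 - b := by
      rw [← Complex.ofReal_one, ← hab]
      push_cast
      ring
    rw [hab'] at h1
    push_cast
    linear_combination h1
  have := congrArg Complex.im h2
  simp at this
  exact h0 this.symm

/-- The winding number is nonzero somewhere near the midpoint of an edge. -/
theorem exists_winding_ne_zero {n : ℕ} {P : Polygon Plane n} {i : Fin n}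
    (hi : P i ≠ P (finRotate n i))
    (hmid : ∀ j ≠ i, midpoint ℝ (P i) (P (finRotate n i)) ∉
      segment ℝ (P j) (P (finRotate n j))) :
    ∃ x, x ∉ P.boundary ℝ ∧ winding P x ≠ 0 := by
  set q := bisectorPoint (P i) (P (finRotate n i)) with hq
  have hq0 : q 0 = midpoint ℝ (P i) (P (finRotate n i)) := by simp [hq, bisectorPoint]
  have hqc : Tendsto q (𝓝 0) (𝓝 (q 0)) := by
    have : Continuous q := by
      rw [hq]
      unfold bisectorPoint
      fun_prop
    exact this.continuousAt
  set G : Plane → ℝ := fun x => ∑ j ∈ Finset.univ.erase i,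
    (viewRatio (P j) (P (finRotate n j)) x).arg with hG
  have hW : ∀ x, winding P x = (viewRatio (P i) (P (finRotate n i)) x).arg + G x := fun x =>
    (Finset.add_sum_erase _ _ (Finset.mem_univ i)).symm
  have hGc : Tendsto G (𝓝 (q 0)) (𝓝 (G (q 0))) := tendsto_finsetSum _ fun j hj =>
    (continuousAt_arg_viewRatio (by rw [hq0]; exact hmid j (Finset.ne_of_mem_erase hj))).tendsto
  have hpi := Real.pi_pos
  have hGe : ∀ᶠ ε in 𝓝 (0 : ℝ), |G (q ε) - G (q 0)| < Real.pi / 2 := by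
    have := ((hGc.comp hqc).sub_const (G (q 0))).abs
    rw [sub_self, abs_zero] at this
    exact this.eventually_lt_const (by positivity)
  have hoff : ∀ᶠ ε in 𝓝 (0 : ℝ), ∀ j ≠ i, q ε ∉ segment ℝ (P j) (P (finRotate n j)) := by
    rw [eventually_all]
    intro j
    by_cases hj : j = i
    · simp [hj]
    · have hopen : IsOpen (segment ℝ (P j) (P (finRotate n j)))ᶜ :=
        (isCompact_segment _ _).isClosed.isOpen_compl
      filter_upwards [hqc.eventually (hopen.mem_nhds (by rw [hq0]; exact hmid j hj))] with ε hε _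
      exact hε
  have hneg : Tendsto (fun ε : ℝ => -ε) (𝓝 0) (𝓝 0) := by
    simpa using (continuous_neg (G := ℝ)).tendsto 0
  have hall := (((hGe.and hoff).and (hneg.eventually (hGe.and hoff))).and
    (eventually_lt_nhds (show (0 : ℝ) < 1 / 2 by norm_num)))
  obtain ⟨ε, ⟨⟨⟨hG1, ho1⟩, hG2, ho2⟩, hε⟩, hε0⟩ :=
    ((hall.filter_mono nhdsWithin_le_nhds).and (self_mem_nhdsWithin (s := Ioi (0 : ℝ)))).exists
  have hε0' : 0 < ε := hε0
  have hb : ∀ δ : ℝ, δ ≠ 0 → (∀ j ≠ i, q δ ∉ segment ℝ (P j) (P (finRotate n j))) →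
      q δ ∉ P.boundary ℝ := by
    intro δ hδ h
    rw [notMem_boundary_iff]
    intro j
    by_cases hj : j = i
    · rw [hj]
      exact bisectorPoint_notMem_segment hi hδ
    · exact h j hj
  -- Crossing the edge changes its own argument by more than `π`, while the other terms together
  -- change by less than `π`; both winding numbers cannot vanish.
  by_contra! hcon
  have e1 := hcon _ (hb ε hε0'.ne' ho1)
  have e2 := hcon _ (hb (-ε) (neg_ne_zero.mpr hε0'.ne') ho2)
  rw [hW] at e1 e2
  have a1 := pi_div_two_lt_arg_viewRatio hi hε0' hε
  have a2 := arg_viewRatio_lt_neg_pi_div_two hi hε0' hε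
  rw [abs_lt] at hG1 hG2
  simp only [hq] at e1 e2 hG1 hG2
  linarith

/-! ### The two components of the complement -/

/-- A proper union of components of `S` is polygonally connected, if `S` is covered by two sets
any two points of which are connected by short polygonal paths within `S`. -/
theorem exists_pathIn_of_two_sides {S T A B : Set Plane} {m : ℕ} (hTS : T ⊆ S)
    (hT : ∀ a ∈ T, connectedComponentIn S a ⊆ T) (hz : (S \ T).Nonempty) (hAB : S ⊆ A ∪ B)
    (hA : ∀ a ∈ A, ∀ b ∈ A, ∃ k ≤ m, PathIn S k a b)
    (hB : ∀ a ∈ B, ∀ b ∈ B, ∃ k ≤ m, PathIn S k a b) :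
    ∀ a ∈ T, ∀ b ∈ T, ∃ k ≤ m, PathIn T k a b := by
  obtain ⟨z, hzS, hzT⟩ := hz
  intro a ha b hb
  -- A path from `T` to `z` would put `z` in `T`. So whichever of `A`, `B` contains `z` misses `T`,
  -- and `T` lies in the other.
  have hno : ∀ {c k}, c ∈ T → ¬ PathIn S k c z := fun hc h =>
    hzT (hT _ hc h.connectedComponentIn.mem_right)
  have hlift : (∃ k ≤ m, PathIn S k a b) → ∃ k ≤ m, PathIn T k a b := fun ⟨k, hk, h⟩ =>
    ⟨k, hk, h.connectedComponentIn.mono (hT a ha)⟩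
  rcases hAB hzS with hzA | hzB
  · have hmem : ∀ c ∈ T, c ∈ B := fun c hc => (hAB (hTS hc)).resolve_left fun hcA =>
      let ⟨_, _, h⟩ := hA c hcA z hzA
      hno hc h
    exact hlift (hB a (hmem a ha) b (hmem b hb))
  · have hmem : ∀ c ∈ T, c ∈ A := fun c hc => (hAB (hTS hc)).resolve_right fun hcB =>
      let ⟨_, _, h⟩ := hB c hcB z hzB
      hno hc h
    exact hlift (hA a (hmem a ha) b (hmem b hb))

theorem connectedComponentIn_subset_inside {n : ℕ} {P : Polygon Plane n} {a : Plane}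
    (ha : a ∈ inside P) : connectedComponentIn (P.boundary ℝ)ᶜ a ⊆ inside P := fun y hy =>
  ⟨connectedComponentIn_subset _ _ hy, by rw [← connectedComponentIn_eq hy]; exact ha.2⟩

theorem connectedComponentIn_subset_outside {n : ℕ} {P : Polygon Plane n} {a : Plane}
    (ha : a ∈ outside P) : connectedComponentIn (P.boundary ℝ)ᶜ a ⊆ outside P := fun y hy =>
  ⟨connectedComponentIn_subset _ _ hy, by rw [← connectedComponentIn_eq hy]; exact ha.2⟩

theorem IsSimple.inside_nonempty {n : ℕ} {P : Polygon Plane n} (hP : IsSimple P) (hn : 3 ≤ n) :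
    (inside P).Nonempty := by
  obtain ⟨x, hx, hw⟩ := exists_winding_ne_zero (hP.ne_finRotate hn ⟨0, by omega⟩)
    fun j hj => hP.midpoint_notMem hn hj
  refine ⟨x, hx, ?_⟩
  by_contra hb
  exact hw (winding_eq_zero_of_mem_outside ⟨hx, hb⟩)

theorem outside_nonempty {n : ℕ} (P : Polygon Plane n) : (outside P).Nonempty := by
  obtain ⟨R, hR0, hR⟩ := (isCompact_boundary P).isBounded.exists_pos_norm_lt
  obtain ⟨x, hx⟩ := exists_norm_eq Plane hR0.le
  have hray : ∀ t : ℝ, 1 ≤ t → t • x ∈ (P.boundary ℝ)ᶜ := by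
    intro t ht hmem
    have := hR _ hmem
    rw [norm_smul, hx, Real.norm_of_nonneg (by linarith)] at this
    nlinarith
  have hxS : x ∉ P.boundary ℝ := by simpa using hray 1 le_rfl
  have hsub : (fun t : ℝ => t • x) '' Ici 1 ⊆ connectedComponentIn (P.boundary ℝ)ᶜ x := by
    refine (isPreconnected_Ici.image _ (by fun_prop)).subset_connectedComponentIn
      ⟨1, self_mem_Ici, one_smul _ _⟩ ?_
    rintro _ ⟨t, ht, rfl⟩
    exact hray t ht
  refine ⟨x, hxS, fun hb => ?_⟩
  obtain ⟨C, hC0, hC⟩ := hb.exists_pos_norm_le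
  -- At this parameter the point on the ray has norm `R + C`, beyond the supposed bound `C`.
  have h1 : 1 ≤ 1 + C / R := by
    have : 0 < C / R := by positivity
    linarith
  have := hC _ (hsub ⟨1 + C / R, h1, rfl⟩)
  simp only at this
  rw [norm_smul, hx, Real.norm_of_nonneg (by linarith), add_mul, div_mul_cancel₀ _ hR0.ne']
    at this
  linarith

theorem IsSimple.exists_pathIn_inside {n : ℕ} {P : Polygon Plane n} (hP : IsSimple P)
    (hn : 3 ≤ n) : ∀ a ∈ inside P, ∀ b ∈ inside P, ∃ k ≤ n / 2 + 3, PathIn (inside P) k a b := by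
  obtain ⟨A, B, hAB, hA, hB⟩ := hP.exists_two_sides hn
  obtain ⟨z, hz⟩ := outside_nonempty P
  exact exists_pathIn_of_two_sides (fun x hx => hx.1)
    (fun a ha => connectedComponentIn_subset_inside ha) ⟨z, hz.1, fun h => hz.2 h.2⟩ hAB hA hB

theorem IsSimple.exists_pathIn_outside {n : ℕ} {P : Polygon Plane n} (hP : IsSimple P)
    (hn : 3 ≤ n) :
    ∀ a ∈ outside P, ∀ b ∈ outside P, ∃ k ≤ n / 2 + 3, PathIn (outside P) k a b := by
  obtain ⟨A, B, hAB, hA, hB⟩ := hP.exists_two_sides hn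
  obtain ⟨z, hz⟩ := hP.inside_nonempty hn
  exact exists_pathIn_of_two_sides (fun x hx => hx.1)
    (fun a ha => connectedComponentIn_subset_outside ha) ⟨z, hz.1, fun h => h.2 hz.2⟩ hAB hA hB

end PolygonalDiameter

theorem theorem3p1 (n : ℕ) (hn : 3 ≤ n) (P : Polygon PolygonalDiameter.Plane n)
    (hP : PolygonalDiameter.IsSimple P) :
    (PolygonalDiameter.poldiam (PolygonalDiameter.inside P) ≤ ((n / 2 + 3 : ℕ) : ℕ∞) ∧
      PolygonalDiameter.poldiam (PolygonalDiameter.outside P) ≤ ((n / 2 + 3 : ℕ) : ℕ∞)) ∧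
    (PolygonalDiameter.IsPolygonallyConnected (PolygonalDiameter.inside P) ∧
      PolygonalDiameter.IsPolygonallyConnected (PolygonalDiameter.outside P)) ∧
    (IsConnected (PolygonalDiameter.inside P) ∧
      IsConnected (PolygonalDiameter.outside P)) := by
  have hi := hP.exists_pathIn_inside hn
  have ho := hP.exists_pathIn_outside hn
  refine ⟨⟨PolygonalDiameter.poldiam_le hi, PolygonalDiameter.poldiam_le ho⟩,
    ⟨fun a ha b hb => ?_, fun a ha b hb => ?_⟩,
    ⟨hP.inside_nonempty hn, PolygonalDiameter.isPreconnected_of_pathIn fun a ha b hb => ?_⟩,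
    PolygonalDiameter.outside_nonempty P,
    PolygonalDiameter.isPreconnected_of_pathIn fun a ha b hb => ?_⟩
  · obtain ⟨k, -, h⟩ := hi a ha b hb
    exact ⟨k, h⟩
  · obtain ⟨k, -, h⟩ := ho a ha b hb
    exact ⟨k, h⟩
  · obtain ⟨k, -, h⟩ := hi a ha b hb
    exact ⟨k, h⟩
  · obtain ⟨k, -, h⟩ := ho a ha b hb
    exact ⟨k, h⟩
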